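/- For finite sets $\mathcal{W}_1,\dots,\mathcal{W}_r\subset\mathbb{R}^n$ let $$D(\mathcal{W}_1,\dots,\mathcal{W}_r)=\sum_{I\subset\{1,\dots,r\}}(-1)^{r-|I|}\,\Big|\sum_{i\in I}\mathcal{W}_i\Big|$$ be their discrete mixed volume, where $\sum_{i\in I}\mathcal{W}_i$ is the Minkowski sum and the term of $I=\emptyset$ is $(-1)^r$; in particular $D(\mathcal{W},\mathcal{W})=|\mathcal{W}+\mathcal{W}|-2|\mathcal{W}|+1$. A tropical polynomial with support a nonempty finite set $\mathcal{W}\subset\mathbb{R}^n$ is a function $f(x)=\max_{w\in\mathcal{W}}(a_w+\langle w,x\rangle)$ with given coefficients $a_w\in\mathbb{R}$, $w\in\mathcal{W}$. Its tropical hypersurface is the set of points $x\in\mathbb{R}^n$ where this maximum is attained by at least two $w\in\mathcal{W}$. The piece of $f$ through $p\in\mathbb{R}^n$ is the closed polyhedron of all $x$ at which every $w$ that attains the maximum at $p$ still attains it; it is the cell, of the subdivision of $\mathbb{R}^n$ induced by $f$, that contains $p$ in its relative interior. A nondegenerate solution of a system of $n$ tropical polynomial equations in $n$ variables, given by $f_1,\dots,f_n$,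 is a point $p$ that lies on all $n$ tropical hypersurfaces, at which they meet transversely: the codimensions of the pieces of $f_1,\dots,f_n$ through $p$ sum up to the codimension of the intersection of these pieces. Proposition. (1) For every $n$ and every finite set $\mathcal{W}\subset\mathbb{R}^n$, $$D(\mathcal{W},\mathcal{W})\le\frac{(|\mathcal{W}|-1)(|\mathcal{W}|-2)}{2}.$$ (2) A system of two tropical polynomial equations in two variables with the same support $\mathcal{W}\subset\mathbb{R}^2$ has at most $\frac{(|\mathcal{W}|-1)(|\mathcal{W}|-2)}{2}$ nondegenerate solutions. -/

import Mathlib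

open scoped Pointwise

noncomputable section

open Classical in
/-- The discrete mixed volume `D(W₁, …, W_r) = ∑_{I ⊆ [r]} (-1)^(r - |I|) |W_I|` of finite subsets
of `ℝⁿ`, where `W_I = ∑_{i ∈ I} W_i` is the Minkowski sum. The empty Minkowski sum is `{0}`, so
the term of `I = ∅` is `(-1)^r * 1`. -/
def discreteMixedVolume {n r : ℕ} (W : Fin r → Finset (EuclideanSpace ℝ (Fin n))) : ℤ :=
  ∑ I : Finset (Fin r), (-1 : ℤ) ^ (r - I.card) * ((∑ i ∈ I, W i).card : ℤ)

/-- A tropical polynomial in `n` variables: a non-empty finite set of (real) exponent vectors,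
the support, and a real coefficient for each of them. -/
structure TropicalPoly (n : ℕ) where
  support : Finset (EuclideanSpace ℝ (Fin n))
  support_nonempty : support.Nonempty
  coeff : support → ℝ

namespace TropicalPoly

variable {n : ℕ}

/-- The value at `x` of the tropical monomial with exponent `w`: the affine function
`a_w + ⟨w, x⟩`. -/
def monomialValue (f : TropicalPoly n) (w : f.support) (x : EuclideanSpace ℝ (Fin n)) : ℝ :=
  f.coeff w + inner ℝ (w : EuclideanSpace ℝ (Fin n)) x

/-- The value of a tropical polynomial: the maximum of its monomials. -/
def eval (f : TropicalPoly n) (x : EuclideanSpace ℝ (Fin n)) : ℝ :=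
  f.support.attach.sup' f.support_nonempty.attach fun w => f.monomialValue w x

/-- The exponents of the monomials that attain the maximum at `x`. -/
def active (f : TropicalPoly n) (x : EuclideanSpace ℝ (Fin n)) : Set f.support :=
  {w | f.monomialValue w x = f.eval x}

/-- The tropical hypersurface (corner locus): the points where the maximum is attained by at least
two monomials. -/
def hypersurface (f : TropicalPoly n) : Set (EuclideanSpace ℝ (Fin n)) :=
  {x | (f.active x).Nontrivial}

/-- The piece through `p` of the polyhedral subdivision of `ℝⁿ` induced by `f`: the closed
polyhedron of all points at which every monomial that is maximal at `p` is still maximal. It is the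
unique closed cell of the subdivision that contains `p` in its relative interior. -/
def piece (f : TropicalPoly n) (p : EuclideanSpace ℝ (Fin n)) : Set (EuclideanSpace ℝ (Fin n)) :=
  {x | f.active p ⊆ f.active x}

end TropicalPoly

/-- The codimension in `ℝⁿ` of (the affine span of) a set `s`. -/
def codimension {n : ℕ} (s : Set (EuclideanSpace ℝ (Fin n))) : ℕ :=
  n - Module.finrank ℝ (vectorSpan ℝ s)

/-- `p` is a transverse common point of the tropical hypersurfaces of `f₁, …, f_r`: it lies on all
of them, and the codimensions of the pieces that contain `p` in their relative interior sum up to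
the codimension of their common intersection. -/
def IsTransverseAt {n r : ℕ} (f : Fin r → TropicalPoly n) (p : EuclideanSpace ℝ (Fin n)) : Prop :=
  (∀ i, p ∈ (f i).hypersurface) ∧
    ∑ i, codimension ((f i).piece p) = codimension (⋂ i, (f i).piece p)

/-- The nondegenerate solutions of a system of `n` tropical polynomial equations in `n` variables:
the transverse common points of the `n` tropical hypersurfaces. -/
def nondegenerateSolutions {n : ℕ} (f : Fin n → TropicalPoly n) :
    Set (EuclideanSpace ℝ (Fin n)) :=
  {p | IsTransverseAt f p}

end

open Filter Topology

/-! Sums of unordered pairs give |W + W| ≤ C(|W| + 1, 2), and (1) follows. For (2) it suffices that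
the number of solutions is at most D(W, W) = |W + W| - 2|W| + 1 (`card_transverse_add_le`).

Fix a small generic vector u with positive coordinates and a quadrant Q = {x ≤ R} with R large. Tie
s ∈ W + W to a point q if q is the only minimiser of f + g - ⟨s + u, ·⟩ on Q; then s determines q.
Three families of such s arise. A solution p is dual to a parallelogram, and s + u is interior to it
for one of its vertices s. Each w ∈ W gives w + b, where q minimises f - ⟨w + u, ·⟩ on Q and b is
active for g at q. Exchanging f and g gives a + w.

Each family is injective, because q is recovered from s. The first avoids the other two: at a
solution the active exponents of f lie on a line, and w + u is on no line through two points of W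
(`not_isMinOn_of_direction`); the same holds for g. If a is chosen minimal and b maximal in one
coordinate, the other two families meet only in the sum belonging to the corner (R, R)
(`eq_of_add_eq_add`). Hence |P| + 2|W| - 1 ≤ |W + W|. -/

/-! ### Sumset bound and part (1) -/

theorem card_add_self_le {E : Type*} [AddCommMonoid E] [DecidableEq E] (W : Finset E) :
    (W + W).card ≤ (W.card + 1).choose 2 := by
  rw [← Finset.card_sym2]
  have h : W + W ⊆ W.sym2.image
      (Sym2.lift ⟨fun a b : E => a + b, fun a b => add_comm a b⟩) := by
    intro s hs
    obtain ⟨a, ha, b, hb, rfl⟩ := Finset.mem_add.1 hs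
    exact Finset.mem_image.2 ⟨s(a, b), Finset.mk_mem_sym2_iff.2 ⟨ha, hb⟩, rfl⟩
  exact (Finset.card_le_card h).trans Finset.card_image_le

theorem two_mul_card_add_self_le {E : Type*} [AddCommMonoid E] [DecidableEq E] (W : Finset E) :
    2 * ((W + W).card : ℝ) ≤ W.card * (W.card + 1) := by
  have h := card_add_self_le W
  have h' : ((W + W).card : ℝ) ≤ ((W.card + 1).choose 2 : ℕ) := by exact_mod_cast h
  rw [Nat.cast_choose_two] at h'
  push_cast at h'
  linarith

theorem discreteMixedVolume_pair_le {n : ℕ} (W : Finset (EuclideanSpace ℝ (Fin n))) :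
    (discreteMixedVolume ![W, W] : ℝ) ≤ ((W.card : ℝ) - 1) * ((W.card : ℝ) - 2) / 2 := by
  classical
  have hU : (Finset.univ : Finset (Finset (Fin 2))) = {∅, {0}, {1}, {0, 1}} := by decide
  have h := two_mul_card_add_self_le W
  have hD : discreteMixedVolume ![W, W] = ((W + W).card : ℤ) - 2 * W.card + 1 := by
    unfold discreteMixedVolume
    rw [hU, Finset.sum_insert (by decide), Finset.sum_insert (by decide),
      Finset.sum_insert (by decide)]
    simp only [Finset.sum_pair (show (0 : Fin 2) ≠ 1 by decide), Finset.sum_empty,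
      Finset.sum_singleton, Finset.card_empty, Finset.card_singleton, Finset.card_pair (show (0 : Fin 2) ≠ 1 by decide),
      Matrix.cons_val_zero, Matrix.cons_val_one,
      Finset.card_zero]
    -- The sumset in the definition carries its own decidability instance; the cardinality does not
    -- depend on it.
    have e : ∀ i : DecidableEq (EuclideanSpace ℝ (Fin n)),
        (@HAdd.hAdd _ _ _ (@instHAdd _ (@Finset.add _ i _)) W W).card = (W + W).card := by
      intro i; congr!
    norm_num [e]
    ring
  rw [hD]
  push_cast
  nlinarith

/-! ### Unique minimisers and plane determinants -/

/-- `q` is the only minimiser of `h` on `s`. -/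
def IsUniqueMinOn {α : Type*} (h : α → ℝ) (s : Set α) (q : α) : Prop :=
  q ∈ s ∧ ∀ x ∈ s, h x ≤ h q → x = q

theorem IsUniqueMinOn.eq {α : Type*} {h : α → ℝ} {s : Set α} {p q : α}
    (hp : IsUniqueMinOn h s p) (hq : IsUniqueMinOn h s q) : p = q := by
  rcases le_total (h p) (h q) with H | H
  · exact hq.2 p hp.1 H
  · exact (hp.2 q hq.1 H).symm

theorem IsUniqueMinOn.le {α : Type*} {h : α → ℝ} {s : Set α} {q : α}
    (hq : IsUniqueMinOn h s q) (x : α) (hx : x ∈ s) : h q ≤ h x := by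
  by_contra! hlt
  rw [hq.2 x hx hlt.le] at hlt
  exact lt_irrefl _ hlt

theorem IsUniqueMinOn.add {α : Type*} {h k : α → ℝ} {s : Set α} {q : α}
    (hq : IsUniqueMinOn h s q) (hk : ∀ x ∈ s, k q ≤ k x) :
    IsUniqueMinOn (fun x => h x + k x) s q := by
  refine ⟨hq.1, fun x hx hle => hq.2 x hx ?_⟩
  have := hk x hx
  simp only at hle
  linarith

theorem inner_eq_coords (v x : EuclideanSpace ℝ (Fin 2)) :
    inner ℝ v x = v 0 * x 0 + v 1 * x 1 := by
  simp [PiLp.inner_apply, Fin.sum_univ_two, mul_comm]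

/-- The determinant of two plane vectors. -/
noncomputable def planeDet (v w : EuclideanSpace ℝ (Fin 2)) : ℝ := v 0 * w 1 - v 1 * w 0

theorem planeDet_eq_zero_of_inner {v w d : EuclideanSpace ℝ (Fin 2)} (hd : d ≠ 0)
    (hv : inner ℝ v d = 0) (hw : inner ℝ w d = 0) : planeDet v w = 0 := by
  rw [inner_eq_coords] at hv hw
  unfold planeDet
  by_contra h
  refine hd ?_
  have h0 : (v 0 * w 1 - v 1 * w 0) * d 0 = 0 := by linear_combination w 1 * hv - v 1 * hw
  have h1 : (v 0 * w 1 - v 1 * w 0) * d 1 = 0 := by linear_combination v 0 * hw - w 0 * hv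
  ext i
  fin_cases i
  · simpa [h] using h0
  · simpa [h] using h1

theorem inner_eq_zero_of_planeDet {v w d : EuclideanSpace ℝ (Fin 2)} (hv : v ≠ 0)
    (h : planeDet v w = 0) (hd : inner ℝ v d = 0) : inner ℝ w d = 0 := by
  rw [inner_eq_coords] at hd ⊢
  unfold planeDet at h
  by_contra hne
  refine hv ?_
  have h0 : (w 0 * d 0 + w 1 * d 1) * v 0 = 0 := by linear_combination w 0 * hd + d 1 * h
  have h1 : (w 0 * d 0 + w 1 * d 1) * v 1 = 0 := by linear_combination w 1 * hd - d 0 * h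
  ext i
  fin_cases i
  · simpa [hne] using h0
  · simpa [hne] using h1

/-! ### Active monomials, first-order conditions and transversality -/

namespace TropicalPoly

section General

variable {n : ℕ} (f : TropicalPoly n)

theorem monomialValue_le_eval (w : f.support) (x : EuclideanSpace ℝ (Fin n)) :
    f.monomialValue w x ≤ f.eval x :=
  Finset.le_sup' (fun w => f.monomialValue w x) (Finset.mem_attach _ w)

theorem exists_mem_active (x : EuclideanSpace ℝ (Fin n)) : ∃ w, w ∈ f.active x := by
  obtain ⟨w, -, hw⟩ := Finset.exists_mem_eq_sup' f.support_nonempty.attach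
    (fun w => f.monomialValue w x)
  exact ⟨w, hw.symm⟩

theorem monomialValue_add (w : f.support) (x y : EuclideanSpace ℝ (Fin n)) :
    f.monomialValue w (x + y) = f.monomialValue w x
      + inner ℝ (w : EuclideanSpace ℝ (Fin n)) y := by
  simp only [monomialValue, inner_add_right]; ring

theorem continuous_monomialValue (w : f.support) : Continuous (f.monomialValue w) := by
  unfold monomialValue; fun_prop

theorem continuous_eval : Continuous f.eval := by
  unfold eval
  exact Continuous.finset_sup'_apply _ fun w _ => f.continuous_monomialValue w

theorem eventually_active_subset (p : EuclideanSpace ℝ (Fin n)) :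
    ∀ᶠ x in 𝓝 p, f.active x ⊆ f.active p := by
  have h : ∀ w : f.support, ∀ᶠ x in 𝓝 p, w ∈ f.active x → w ∈ f.active p := by
    intro w
    by_cases hw : w ∈ f.active p
    · exact Eventually.of_forall fun _ _ => hw
    · have hlt : f.monomialValue w p < f.eval p := lt_of_le_of_ne (f.monomialValue_le_eval w p) hw
      filter_upwards [(f.continuous_monomialValue w).continuousAt.eventually_lt
        f.continuous_eval.continuousAt hlt] with x hx hxa
      exact absurd hxa hx.ne
  filter_upwards [eventually_all.2 h] with x hx w hw using hx w hw

theorem eventually_active_line (p d : EuclideanSpace ℝ (Fin n)) :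
    ∀ᶠ t in 𝓝 (0 : ℝ), f.active (p + t • d) ⊆ f.active p := by
  have hc : Tendsto (fun t : ℝ => p + t • d) (𝓝 0) (𝓝 p) := by
    have : Continuous (fun t : ℝ => p + t • d) := by fun_prop
    simpa using this.tendsto 0
  exact hc.eventually (f.eventually_active_subset p)

/-- `f` minus the linear form given by `v`. -/
noncomputable def tilt (v x : EuclideanSpace ℝ (Fin n)) : ℝ := f.eval x - inner ℝ v x

variable {f}

/-- First-order condition at a minimiser in a feasible direction. -/
theorem exists_active_inner_ge {v q d : EuclideanSpace ℝ (Fin n)}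
    {Q : Set (EuclideanSpace ℝ (Fin n))} (hmin : ∀ x ∈ Q, f.tilt v q ≤ f.tilt v x)
    (hd : ∀ᶠ t in 𝓝[>] (0 : ℝ), q + t • d ∈ Q) :
    ∃ a ∈ f.active q, inner ℝ v d ≤ inner ℝ (a : EuclideanSpace ℝ (Fin n)) d := by
  obtain ⟨t, ⟨htQ, hta⟩, ht⟩ := ((hd.and
    ((f.eventually_active_line q d).filter_mono nhdsWithin_le_nhds)).and
      self_mem_nhdsWithin).exists
  obtain ⟨a, ha⟩ := f.exists_mem_active (q + t • d)
  refine ⟨a, hta ha, ?_⟩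
  have h1 := hmin _ htQ
  have h2 : f.monomialValue a q = f.eval q := hta ha
  have h3 : f.monomialValue a (q + t • d) = f.eval (q + t • d) := ha
  rw [monomialValue_add, h2, inner_smul_right] at h3
  simp only [tilt, inner_add_right, inner_smul_right, ← h3] at h1
  have ht' : (0 : ℝ) < t := ht
  nlinarith

/-- Along `d` all monomials active at `p` grow at the same rate, and close to `p` no other monomial
can overtake them. -/
theorem active_line_eq {p d : EuclideanSpace ℝ (Fin n)}
    (hd : ∀ a ∈ f.active p, ∀ b ∈ f.active p,
      inner ℝ ((a : EuclideanSpace ℝ (Fin n)) - b) d = 0) :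
    ∀ᶠ t in 𝓝 (0 : ℝ), f.active p ⊆ f.active (p + t • d) := by
  filter_upwards [f.eventually_active_line p d] with t ht a ha
  obtain ⟨b, hb⟩ := f.exists_mem_active (p + t • d)
  have h1 : f.monomialValue a p = f.eval p := ha
  have h2 : f.monomialValue b p = f.eval p := ht hb
  have h3 : f.monomialValue b (p + t • d) = f.eval (p + t • d) := hb
  have h4 := hd a ha b (ht hb)
  change f.monomialValue a (p + t • d) = f.eval (p + t • d)
  rw [← h3, monomialValue_add, monomialValue_add, h1, h2, inner_smul_right, inner_smul_right]
  rw [inner_sub_left] at h4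
  rw [sub_eq_zero.1 h4]

theorem inner_active_sub_eq_zero {p x d : EuclideanSpace ℝ (Fin n)} {a b : f.support}
    (ha : a ∈ f.active p) (hb : b ∈ f.active p)
    (hx : x ∈ f.piece p) (hd : x + d ∈ f.piece p) :
    inner ℝ ((a : EuclideanSpace ℝ (Fin n)) - b) d = 0 := by
  have h1 : f.monomialValue a x = f.eval x := hx ha
  have h2 : f.monomialValue b x = f.eval x := hx hb
  have h3 : f.monomialValue a (x + d) = f.eval (x + d) := hd ha
  have h4 : f.monomialValue b (x + d) = f.eval (x + d) := hd hb
  rw [monomialValue_add] at h3 h4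
  rw [inner_sub_left]; linarith

theorem inner_eq_zero_of_mem_vectorSpan {p d : EuclideanSpace ℝ (Fin n)} {a b : f.support}
    (ha : a ∈ f.active p) (hb : b ∈ f.active p) (hd : d ∈ vectorSpan ℝ (f.piece p)) :
    inner ℝ ((a : EuclideanSpace ℝ (Fin n)) - b) d = 0 := by
  have h : vectorSpan ℝ (f.piece p) ≤
      LinearMap.ker (innerSL ℝ ((a : EuclideanSpace ℝ (Fin n)) - b)).toLinearMap := by
    refine Submodule.span_le.2 ?_
    rintro _ ⟨x, hx, y, hy, rfl⟩
    have := inner_active_sub_eq_zero (x := y) (d := x - y) ha hb hy (by simpa using hx)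
    simpa [inner_sub_left] using this
  simpa [inner_sub_left] using h hd

end General

section Plane

variable {f g : TropicalPoly 2} {p : EuclideanSpace ℝ (Fin 2)}

theorem finrank_vectorSpan_piece_le (hp : p ∈ f.hypersurface) :
    Module.finrank ℝ (vectorSpan ℝ (f.piece p)) ≤ 1 := by
  obtain ⟨a, ha, b, hb, hab⟩ := hp
  have hne : ((a : EuclideanSpace ℝ (Fin 2)) - b) ≠ 0 :=
    sub_ne_zero.2 fun h => hab (Subtype.ext h)
  have hlt : vectorSpan ℝ (f.piece p) < ⊤ := by
    refine lt_top_iff_ne_top.2 fun h => hne ?_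
    have := inner_eq_zero_of_mem_vectorSpan (f := f) (p := p)
      (d := (a : EuclideanSpace ℝ (Fin 2)) - b) ha hb (h ▸ Submodule.mem_top)
    simpa using this
  have := Submodule.finrank_lt_finrank_of_lt hlt
  rw [finrank_top, finrank_euclideanSpace_fin] at this
  omega

/-- The pieces through a transverse common point are two segments or rays in independent
directions. -/
theorem exists_directions_of_isTransverseAt (h : IsTransverseAt ![f, g] p) :
    (∃ a ∈ f.active p, ∃ a' ∈ f.active p, ∃ b ∈ g.active p, ∃ b' ∈ g.active p,
      planeDet ((a : EuclideanSpace ℝ (Fin 2)) - a') ((b : EuclideanSpace ℝ (Fin 2)) - b') ≠ 0) ∧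
    (∃ d ≠ 0, ∀ a ∈ f.active p, ∀ b ∈ f.active p,
      inner ℝ ((a : EuclideanSpace ℝ (Fin 2)) - b) d = 0) ∧
    (∃ d ≠ 0, ∀ a ∈ g.active p, ∀ b ∈ g.active p,
      inner ℝ ((a : EuclideanSpace ℝ (Fin 2)) - b) d = 0) := by
  obtain ⟨hH, hc⟩ := h
  have hf : p ∈ f.hypersurface := hH 0
  have hg : p ∈ g.hypersurface := hH 1
  have h1 := finrank_vectorSpan_piece_le hf
  have h2 := finrank_vectorSpan_piece_le hg
  set S : Set (EuclideanSpace ℝ (Fin 2)) := ⋂ i, (![f, g] i).piece p with hS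
  rw [Fin.sum_univ_two] at hc
  change codimension (f.piece p) + codimension (g.piece p) = codimension S at hc
  unfold codimension at hc
  have hdir : ∀ k : TropicalPoly 2, Module.finrank ℝ (vectorSpan ℝ (k.piece p)) = 1 →
      ∃ d ≠ 0, ∀ a ∈ k.active p, ∀ b ∈ k.active p,
        inner ℝ ((a : EuclideanSpace ℝ (Fin 2)) - b) d = 0 := by
    intro k hk
    have hbot : vectorSpan ℝ (k.piece p) ≠ ⊥ := by
      intro h0; rw [h0, finrank_bot] at hk; omega
    obtain ⟨d, hd, hd0⟩ := Submodule.exists_mem_ne_zero_of_ne_bot hbot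
    exact ⟨d, hd0, fun a ha b hb => inner_eq_zero_of_mem_vectorSpan ha hb hd⟩
  -- Both codimensions are at least 1 and their sum is at most 2, so each is 1; the intersection
  -- then has dimension 0.
  obtain ⟨d, hd0, hd⟩ := hdir f (by omega)
  obtain ⟨e, he0, he⟩ := hdir g (by omega)
  refine ⟨?_, ⟨d, hd0, hd⟩, ⟨e, he0, he⟩⟩
  obtain ⟨a, ha, a', ha', haa⟩ := hf
  have hane : ((a : EuclideanSpace ℝ (Fin 2)) - a') ≠ 0 :=
    sub_ne_zero.2 fun h => haa (Subtype.ext h)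
  -- If all edges were parallel, `d` would also keep the active set of `g`, and the intersection of
  -- the pieces would contain a point other than `p`.
  by_contra! hpar
  have hd' : ∀ b ∈ g.active p, ∀ b' ∈ g.active p,
      inner ℝ ((b : EuclideanSpace ℝ (Fin 2)) - b') d = 0 := fun b hb b' hb' =>
    inner_eq_zero_of_planeDet hane (hpar a ha a' ha' b hb b' hb') (hd a ha a' ha')
  obtain ⟨t, ⟨htf, htg⟩, ht⟩ := ((((active_line_eq hd).and (active_line_eq hd')).filter_mono
    (nhdsWithin_le_nhds (s := Set.Ioi 0))).and self_mem_nhdsWithin).exists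
  have ht' : (0 : ℝ) < t := ht
  have hp1 : p ∈ S := Set.mem_iInter.2 (by
    intro i; fin_cases i <;> exact fun _ h => h)
  have hp2 : p + t • d ∈ S := Set.mem_iInter.2 (by
    intro i; fin_cases i
    · exact htf
    · exact htg)
  have hmem : t • d ∈ vectorSpan ℝ S := by
    have := vsub_mem_vectorSpan ℝ hp2 hp1
    simpa using this
  have h0 : vectorSpan ℝ S = ⊥ := Submodule.finrank_eq_zero.1 (by omega)
  rw [h0, Submodule.mem_bot, smul_eq_zero] at hmem
  rcases hmem with h | h
  · exact ht'.ne' h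
  · exact hd0 h

end Plane

end TropicalPoly

/-! ### Generic shifts -/

/-- A small vector `u` in the positive quadrant, in general position with respect to `W`. -/
structure IsGenericShift (W : Finset (EuclideanSpace ℝ (Fin 2)))
    (u : EuclideanSpace ℝ (Fin 2)) : Prop where
  pos : ∀ i, 0 < u i
  coord_le : ∀ a ∈ W, ∀ w ∈ W, ∀ i, a i ≤ w i + u i → a i ≤ w i
  height_le : ∀ a ∈ W, ∀ w ∈ W, a 0 + a 1 ≤ w 0 + w 1 + (u 0 + u 1) → a 0 + a 1 ≤ w 0 + w 1
  det_ne : ∀ a ∈ W, ∀ a' ∈ W, ∀ w ∈ W, a ≠ a' → planeDet (a - w - u) (a - a') ≠ 0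
  det_lt : ∀ a ∈ W, ∀ a' ∈ W, ∀ b ∈ W, ∀ b' ∈ W, planeDet (a - a') (b - b') ≠ 0 →
    |planeDet u (b - b')| < |planeDet (a - a') (b - b')|

theorem eventually_sub_mul_ne_zero {c k : ℝ} (h : c ≠ 0 ∨ k ≠ 0) :
    ∀ᶠ ε in 𝓝[>] (0 : ℝ), c - ε * k ≠ 0 := by
  by_cases hc : c = 0
  · have hk : k ≠ 0 := h.resolve_left (not_not.2 hc)
    filter_upwards [self_mem_nhdsWithin] with ε hε
    have : (0 : ℝ) < ε := hε
    rw [hc, zero_sub]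
    exact neg_ne_zero.2 (mul_ne_zero this.ne' hk)
  · refine Eventually.filter_mono nhdsWithin_le_nhds ?_
    have : Continuous fun ε : ℝ => c - ε * k := by fun_prop
    exact this.continuousAt.eventually_ne (by simpa using hc)

theorem eventually_mul_lt {k c : ℝ} (hc : 0 < c) : ∀ᶠ ε in 𝓝[>] (0 : ℝ), ε * k < c := by
  refine Eventually.filter_mono nhdsWithin_le_nhds ?_
  have : Continuous fun ε : ℝ => ε * k := by fun_prop
  exact this.continuousAt.eventually_lt continuousAt_const (by simpa using hc)

theorem eventually_le_of_le_add_mul (x y k : ℝ) :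
    ∀ᶠ ε in 𝓝[>] (0 : ℝ), x ≤ y + ε * k → x ≤ y := by
  by_cases h : x ≤ y
  · exact Eventually.of_forall fun _ _ => h
  · filter_upwards [eventually_mul_lt (k := k) (sub_pos.2 (not_le.1 h))] with ε hε hle
    linarith

/-- Take u = ε(1, η). With η different from the slopes of all differences in W, u is parallel to
none of them; each condition then holds for all small ε > 0. Geometrically, `det_ne` keeps w + u off
every line through two points of W, and `det_lt` bounds the coordinates of u in a basis of two
edges. -/
theorem exists_isGenericShift (W : Finset (EuclideanSpace ℝ (Fin 2))) :
    ∃ u, IsGenericShift W u := by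
  have hη : ∀ᶠ η : ℝ in 𝓝[>] 0, ∀ a ∈ W, ∀ a' ∈ W, a ≠ a' →
      (a 1 - a' 1) - η * (a 0 - a' 0) ≠ 0 := by
    refine (eventually_all_finset W).2 fun a _ => (eventually_all_finset W).2 fun a' _ => ?_
    by_cases h : a = a'
    · exact Eventually.of_forall fun _ hne => absurd h hne
    · refine (eventually_sub_mul_ne_zero ?_).mono fun _ H _ => H
      by_contra! hne
      refine h ?_
      ext i
      fin_cases i
      · exact sub_eq_zero.1 hne.2
      · exact sub_eq_zero.1 hne.1
  obtain ⟨η, hη, hη0⟩ := (hη.and self_mem_nhdsWithin).exists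
  have hη0 : (0 : ℝ) < η := hη0
  have h1 : ∀ᶠ ε : ℝ in 𝓝[>] 0, ∀ a ∈ W, ∀ w ∈ W, ∀ i, a i ≤ w i + (ε * ![1, η] i) →
      a i ≤ w i :=
    (eventually_all_finset W).2 fun a _ => (eventually_all_finset W).2 fun w _ =>
      eventually_all.2 fun i => eventually_le_of_le_add_mul _ _ _
  have h2 : ∀ᶠ ε : ℝ in 𝓝[>] 0, ∀ a ∈ W, ∀ w ∈ W,
      a 0 + a 1 ≤ w 0 + w 1 + ε * (1 + η) → a 0 + a 1 ≤ w 0 + w 1 :=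
    (eventually_all_finset W).2 fun a _ => (eventually_all_finset W).2 fun w _ =>
      eventually_le_of_le_add_mul _ _ _
  have h3 : ∀ᶠ ε : ℝ in 𝓝[>] 0, ∀ a ∈ W, ∀ a' ∈ W, ∀ w ∈ W, a ≠ a' →
      planeDet (a - w) (a - a') - ε * ((a 1 - a' 1) - η * (a 0 - a' 0)) ≠ 0 := by
    refine (eventually_all_finset W).2 fun a ha => (eventually_all_finset W).2 fun a' ha' =>
      (eventually_all_finset W).2 fun w _ => ?_
    by_cases h : a = a'
    · exact Eventually.of_forall fun _ hne => absurd h hne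
    · exact (eventually_sub_mul_ne_zero (Or.inr (hη a ha a' ha' h))).mono fun _ H _ => H
  have h4 : ∀ᶠ ε : ℝ in 𝓝[>] 0, ∀ a ∈ W, ∀ a' ∈ W, ∀ b ∈ W, ∀ b' ∈ W,
      planeDet (a - a') (b - b') ≠ 0 →
      ε * |(b 1 - b' 1) - η * (b 0 - b' 0)| < |planeDet (a - a') (b - b')| := by
    refine (eventually_all_finset W).2 fun a _ => (eventually_all_finset W).2 fun a' _ =>
      (eventually_all_finset W).2 fun b _ => (eventually_all_finset W).2 fun b' _ => ?_
    by_cases h : planeDet (a - a') (b - b') = 0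
    · exact Eventually.of_forall fun _ hne => absurd h hne
    · exact (eventually_mul_lt (abs_pos.2 h)).mono fun _ H _ => H
  obtain ⟨ε, ⟨⟨⟨h1, h2⟩, h3⟩, h4⟩, hε⟩ :=
    ((((h1.and h2).and h3).and h4).and self_mem_nhdsWithin).exists
  have hε : (0 : ℝ) < ε := hε
  have hu : ∀ i, (WithLp.toLp 2 ![ε * 1, ε * η] : EuclideanSpace ℝ (Fin 2)) i
      = ε * ![1, η] i := by
    intro i; fin_cases i <;> simp
  refine ⟨WithLp.toLp 2 ![ε * 1, ε * η], ?_, ?_, ?_, ?_, ?_⟩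
  · intro i
    rw [hu]
    fin_cases i <;> simp [hε, hη0]
  · intro a ha w hw i h
    rw [hu] at h
    exact h1 a ha w hw i h
  · intro a ha w hw h
    refine h2 a ha w hw ?_
    rw [hu, hu] at h
    simp only [Matrix.cons_val_zero, Matrix.cons_val_one] at h
    linarith
  · intro a ha a' ha' w hw hne h
    refine h3 a ha a' ha' w hw hne ?_
    rw [← h]
    simp only [planeDet, PiLp.sub_apply, Matrix.cons_val_zero, Matrix.cons_val_one]
    ring
  · intro a ha a' ha' b hb b' hb' hne
    have h := h4 a ha a' ha' b hb b' hb' hne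
    rw [← abs_of_pos hε, ← abs_mul] at h
    refine lt_of_eq_of_lt (congrArg _ ?_) h
    simp only [planeDet, PiLp.sub_apply, Matrix.cons_val_zero, Matrix.cons_val_one]
    ring

/-! ### Minimisers on a quadrant -/

/-- The closed quadrant with corner `(R, R)`. -/
def quadrant (R : ℝ) : Set (EuclideanSpace ℝ (Fin 2)) := {x | ∀ i, x i ≤ R}

theorem eventually_mem_quadrant {R : ℝ} {q d : EuclideanSpace ℝ (Fin 2)} (hq : q ∈ quadrant R)
    (hd : ∀ i, q i < R ∨ d i ≤ 0) : ∀ᶠ t in 𝓝[>] (0 : ℝ), q + t • d ∈ quadrant R := by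
  refine eventually_all.2 fun i => ?_
  rcases hd i with h | h
  · filter_upwards [eventually_mul_lt (k := d i) (sub_pos.2 h)] with t ht
    simp only [PiLp.add_apply, PiLp.smul_apply, smul_eq_mul]
    linarith
  · filter_upwards [self_mem_nhdsWithin] with t ht
    have ht : (0 : ℝ) < t := ht
    simp only [PiLp.add_apply, PiLp.smul_apply, smul_eq_mul]
    have := hq i
    nlinarith

theorem isCompact_box (L R : ℝ) :
    IsCompact {x : EuclideanSpace ℝ (Fin 2) | ∀ i, L ≤ x i ∧ x i ≤ R} := by
  have h := (EuclideanSpace.equiv (Fin 2) ℝ).toHomeomorph.isCompact_preimage.2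
    (isCompact_Icc (a := fun _ : Fin 2 => L) (b := fun _ => R))
  convert h using 1
  ext x
  simp [Pi.le_def, forall_and]

namespace TropicalPoly

variable {W : Finset (EuclideanSpace ℝ (Fin 2))} {u : EuclideanSpace ℝ (Fin 2)} {R : ℝ}
  {f g : TropicalPoly 2}

/-- Since f dominates its monomial w, the tilted function is at least `f.coeff w` - ⟨u, x⟩, which
tends to infinity on the quadrant because u is positive. A large box therefore contains a global
minimiser. -/
theorem exists_isMinOn_quadrant (hu : ∀ i, 0 < u i) (R : ℝ) (w : f.support) :
    ∃ q ∈ quadrant R, ∀ x ∈ quadrant R,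
      f.tilt ((w : EuclideanSpace ℝ (Fin 2)) + u) q
        ≤ f.tilt ((w : EuclideanSpace ℝ (Fin 2)) + u) x := by
  set h := f.tilt ((w : EuclideanSpace ℝ (Fin 2)) + u) with hh
  have hcont : Continuous h := by
    have := f.continuous_eval
    rw [hh]; unfold tilt; fun_prop
  have hlow : ∀ x, f.coeff w - (u 0 * x 0 + u 1 * x 1) ≤ h x := by
    intro x
    have h1 := f.monomialValue_le_eval w x
    simp only [hh, tilt, inner_add_left, ← inner_eq_coords]
    unfold monomialValue at h1
    linarith
  set c : EuclideanSpace ℝ (Fin 2) := WithLp.toLp 2 fun _ => R with hc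
  have hcR : ∀ i, c i = R := fun i => rfl
  -- Once one coordinate is below -K, this makes the lower bound exceed the value at the corner `c`;
  -- |R| bounds the other coordinate.
  have hev : ∀ i, ∀ᶠ K in atTop, h c - f.coeff w + (u 0 + u 1) * |R| < u i * K := fun i =>
    (tendsto_id.const_mul_atTop (hu i)).eventually_gt_atTop _
  obtain ⟨K, hK, hKR⟩ := ((eventually_all.2 hev).and (eventually_ge_atTop (-R))).exists
  obtain ⟨q, hq, hmin⟩ := (isCompact_box (-K) R).exists_isMinOn
    ⟨c, fun i => ⟨by rw [hcR]; linarith, (hcR i).le⟩⟩ hcont.continuousOn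
  refine ⟨q, fun i => (hq i).2, fun x hx => ?_⟩
  by_cases hxB : ∀ i, -K ≤ x i
  · exact hmin (fun i => ⟨hxB i, hx i⟩)
  · push Not at hxB
    obtain ⟨i, hi⟩ := hxB
    have hqc : h q ≤ h c := hmin (fun i => ⟨by rw [hcR]; linarith, (hcR i).le⟩)
    refine hqc.trans (le_trans ?_ (hlow x))
    have hR := le_abs_self R
    have hR' := abs_nonneg R
    have hKi := hK i
    have hx0 := hx 0
    have hx1 := hx 1
    have hu0 := hu 0
    have hu1 := hu 1
    have m0 : u 0 * x 0 ≤ u 0 * |R| := mul_le_mul_of_nonneg_left (hx0.trans hR) hu0.le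
    have m1 : u 1 * x 1 ≤ u 1 * |R| := mul_le_mul_of_nonneg_left (hx1.trans hR) hu1.le
    have mi : u i * x i ≤ u i * (-K) := mul_le_mul_of_nonneg_left hi.le (hu i).le
    have p0 := mul_nonneg hu0.le hR'
    have p1 := mul_nonneg hu1.le hR'
    fin_cases i
    · simp only [Fin.zero_eta] at mi hKi
      linarith
    · simp only [Fin.mk_one] at mi hKi
      linarith

/-- By convexity the midpoint of two minimisers is a minimiser, and for every a active there a - w -
u is orthogonal to the segment. Two active exponents would put w + u on the line through them; a
single one violates a first-order condition. -/
theorem eq_of_isMinOn_quadrant (hu : IsGenericShift W u) (hf : f.support = W)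
    {w q q' : EuclideanSpace ℝ (Fin 2)} (hw : w ∈ W) (hqR : q ∈ quadrant R)
    (hqR' : q' ∈ quadrant R) (hq : ∀ x ∈ quadrant R, f.tilt (w + u) q ≤ f.tilt (w + u) x)
    (hq' : ∀ x ∈ quadrant R, f.tilt (w + u) q' ≤ f.tilt (w + u) x) : q' = q := by
  by_contra hne
  set d := q' - q with hd
  have hd0 : d ≠ 0 := sub_ne_zero.2 hne
  set m := q + (1 / 2 : ℝ) • d with hm
  have hmR : m ∈ quadrant R := by
    intro i
    have h1 := hqR i
    have h2 := hqR' i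
    simp only [hm, hd, PiLp.add_apply, PiLp.smul_apply, PiLp.sub_apply, smul_eq_mul]
    linarith
  have heq : f.tilt (w + u) q = f.tilt (w + u) q' := le_antisymm (hq _ hqR') (hq' _ hqR)
  have hq'd : q' = q + d := by rw [hd]; abel
  have key : ∀ a ∈ f.active m, inner ℝ ((a : EuclideanSpace ℝ (Fin 2)) - w - u) d = 0 ∧
      f.tilt (w + u) m = f.tilt (w + u) q := by
    intro a ha
    have e1 : f.monomialValue a m = f.eval m := ha
    have e2 := hq _ hmR
    have e3 := f.monomialValue_le_eval a q
    have e4 := f.monomialValue_le_eval a q'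
    rw [hq'd, monomialValue_add, ← hq'd] at e4
    rw [hm, monomialValue_add, inner_smul_right, ← hm] at e1
    have e5 := heq
    simp only [tilt, hq'd, inner_add_right] at e5
    rw [← hq'd] at e5
    simp only [tilt, hm, inner_add_right, inner_smul_right] at e2
    rw [← hm] at e2
    refine ⟨?_, ?_⟩
    · rw [sub_sub, inner_sub_left]; linarith
    · simp only [tilt, hm, inner_add_right, inner_smul_right]
      rw [← hm]
      linarith
  obtain ⟨a, ha⟩ := f.exists_mem_active m
  obtain ⟨had, hmq⟩ := key a ha
  have haW : (a : EuclideanSpace ℝ (Fin 2)) ∈ W := hf ▸ a.2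
  have hmmin : ∀ x ∈ quadrant R, f.tilt (w + u) m ≤ f.tilt (w + u) x := hmq ▸ hq
  by_cases hs : ∃ b ∈ f.active m, b ≠ a
  · obtain ⟨b, hb, hba⟩ := hs
    refine hu.det_ne a haW b (hf ▸ b.2) w hw (fun h => hba (Subtype.ext h.symm))
      (planeDet_eq_zero_of_inner hd0 had ?_)
    have hbd := (key b hb).1
    simp only [inner_sub_left] at had hbd ⊢
    linarith
  · push Not at hs
    have hneg : ∀ i, (a : EuclideanSpace ℝ (Fin 2)) i - w i - u i < 0 := by
      intro i
      obtain ⟨b, hb, hle⟩ := exists_active_inner_ge (d := -EuclideanSpace.single i (1 : ℝ)) hmmin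
        (eventually_mem_quadrant hmR fun j => Or.inr (by
          by_cases h : j = i <;> simp [h]))
      rw [hs b hb] at hle
      simp [inner_neg_right, EuclideanSpace.inner_single_right] at hle
      have h1 := hu.coord_le a haW w hw i hle
      have h2 := hu.pos i
      linarith
    rw [inner_eq_coords] at had
    simp only [PiLp.sub_apply] at had
    have n0 := hneg 0
    have n1 := hneg 1
    -- Otherwise both minimisers lie on the edge x 1 = R and `d` is horizontal, which `had` and `n0`
    -- forbid.
    have hm1 : m 1 < R := by
      by_contra hcon
      have h1 := hqR 1
      have h2 := hqR' 1
      have hmi : m 1 = (q 1 + q' 1) / 2 := by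
        simp only [hm, hd, PiLp.add_apply, PiLp.smul_apply, PiLp.sub_apply, smul_eq_mul]; ring
      have hd1 : d 1 = 0 := by
        simp only [hd, PiLp.sub_apply]; linarith
      rw [hd1, mul_zero, add_zero] at had
      refine hd0 ?_
      ext i
      fin_cases i
      · exact (mul_eq_zero.1 had).resolve_left n0.ne
      · exact hd1
    obtain ⟨b, hb, hle⟩ := exists_active_inner_ge (d := EuclideanSpace.single 1 (1 : ℝ)) hmmin
      (eventually_mem_quadrant hmR fun j => by
        fin_cases j
        · right; simp
        · left; exact hm1)
    rw [hs b hb] at hle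
    simp [EuclideanSpace.inner_single_right] at hle
    linarith

theorem exists_isUniqueMinOn_quadrant (hu : IsGenericShift W u) (hf : f.support = W) (R : ℝ)
    {w : EuclideanSpace ℝ (Fin 2)} (hw : w ∈ W) :
    ∃ q, IsUniqueMinOn (f.tilt (w + u)) (quadrant R) q := by
  obtain ⟨q, hqR, hq⟩ := exists_isMinOn_quadrant (f := f) hu.pos R ⟨w, hf ▸ hw⟩
  refine ⟨q, hqR, fun x hx hle => ?_⟩
  exact eq_of_isMinOn_quadrant hu hf hw hqR hx hq fun y hy => hle.trans (hq y hy)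

end TropicalPoly

/-! ### Exponents of the product and their minimisers -/

namespace TropicalPoly

variable {W : Finset (EuclideanSpace ℝ (Fin 2))} {u : EuclideanSpace ℝ (Fin 2)} {R : ℝ}
  {f g : TropicalPoly 2}

/-- The tropical product of `f` and `g` minus the linear form given by `v`. -/
noncomputable def prodTilt (f g : TropicalPoly 2) (v x : EuclideanSpace ℝ (Fin 2)) : ℝ :=
  f.eval x + g.eval x - inner ℝ v x

theorem prodTilt_comm (f g : TropicalPoly 2) : prodTilt f g = prodTilt g f := by
  funext v x
  simp only [prodTilt, add_comm]

theorem tilt_le_of_mem_active {b : g.support} {q : EuclideanSpace ℝ (Fin 2)}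
    (hb : b ∈ g.active q) (x : EuclideanSpace ℝ (Fin 2)) : g.tilt b q ≤ g.tilt b x := by
  have h1 : g.monomialValue b q = g.eval q := hb
  have h2 := g.monomialValue_le_eval b x
  simp only [tilt, ← h1]
  unfold monomialValue at h2 ⊢
  linarith

/-- The function splits as f - ⟨w + u, ·⟩ plus g - ⟨b, ·⟩, and the second summand is minimal at q
because b is active there. -/
theorem isUniqueMinOn_prodTilt {w q : EuclideanSpace ℝ (Fin 2)} {b : g.support}
    {Q : Set (EuclideanSpace ℝ (Fin 2))} (hq : IsUniqueMinOn (f.tilt (w + u)) Q q)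
    (hb : b ∈ g.active q) : IsUniqueMinOn (prodTilt f g (w + b + u)) Q q := by
  convert hq.add fun x _ => tilt_le_of_mem_active hb x using 1
  funext x
  simp only [prodTilt, tilt, inner_add_left]
  ring

/-- The tilt is a convex combination of the four active exponents with positive weights. If x does
no worse than p, all four gaps vanish, so x - p is orthogonal to both edges. -/
theorem isUniqueMinOn_prodTilt_of_mem_parallelogram {p : EuclideanSpace ℝ (Fin 2)}
    {a a' : f.support} {b b' : g.support} {α β : ℝ}
    (ha : a ∈ f.active p) (ha' : a' ∈ f.active p) (hb : b ∈ g.active p) (hb' : b' ∈ g.active p)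
    (hdet : planeDet ((a : EuclideanSpace ℝ (Fin 2)) - a')
      ((b : EuclideanSpace ℝ (Fin 2)) - b') ≠ 0)
    (hα : 0 < α) (hα' : α < 1) (hβ : 0 < β) (hβ' : β < 1)
    (hu : u = α • ((a' : EuclideanSpace ℝ (Fin 2)) - a) +
      β • ((b' : EuclideanSpace ℝ (Fin 2)) - b)) :
    IsUniqueMinOn (prodTilt f g ((a : EuclideanSpace ℝ (Fin 2)) + b + u)) Set.univ p := by
  refine ⟨Set.mem_univ _, fun x _ hle => ?_⟩
  by_contra hne
  have hd0 : x - p ≠ 0 := sub_ne_zero.2 hne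
  have hx : x = p + (x - p) := by abel
  set y := x - p
  have ea := f.monomialValue_le_eval a x
  have ea' := f.monomialValue_le_eval a' x
  have eb := g.monomialValue_le_eval b x
  have eb' := g.monomialValue_le_eval b' x
  have fa : f.monomialValue a p = f.eval p := ha
  have fa' : f.monomialValue a' p = f.eval p := ha'
  have fb : g.monomialValue b p = g.eval p := hb
  have fb' : g.monomialValue b' p = g.eval p := hb'
  rw [hx, monomialValue_add, ← hx] at ea ea' eb eb'
  rw [fa] at ea
  rw [fa'] at ea'
  rw [fb] at eb
  rw [fb'] at eb'
  have hle' : f.eval x + g.eval x - (inner ℝ ((a : EuclideanSpace ℝ (Fin 2)) + b + u) p +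
      inner ℝ ((a : EuclideanSpace ℝ (Fin 2)) + b + u) y) ≤
      f.eval p + g.eval p - inner ℝ ((a : EuclideanSpace ℝ (Fin 2)) + b + u) p := by
    rw [← inner_add_right, ← hx]; exact hle
  have hs : inner ℝ ((a : EuclideanSpace ℝ (Fin 2)) + b + u) y =
      (1 - α) * inner ℝ (a : EuclideanSpace ℝ (Fin 2)) y
      + α * inner ℝ (a' : EuclideanSpace ℝ (Fin 2)) y
      + (1 - β) * inner ℝ (b : EuclideanSpace ℝ (Fin 2)) y
      + β * inner ℝ (b' : EuclideanSpace ℝ (Fin 2)) y := by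
    rw [hu]
    simp only [inner_add_left, inner_sub_left, real_inner_smul_left]
    ring
  rw [hs] at hle'
  have i1 := mul_nonneg (sub_pos.2 hα').le (sub_nonneg.2 ea)
  have i2 := mul_nonneg hα.le (sub_nonneg.2 ea')
  have i3 := mul_nonneg (sub_pos.2 hβ').le (sub_nonneg.2 eb)
  have i4 := mul_nonneg hβ.le (sub_nonneg.2 eb')
  have j1 := (mul_eq_zero.1 (le_antisymm (by linarith) i1)).resolve_left (sub_pos.2 hα').ne'
  have j2 := (mul_eq_zero.1 (le_antisymm (by linarith) i2)).resolve_left hα.ne'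
  have j3 := (mul_eq_zero.1 (le_antisymm (by linarith) i3)).resolve_left (sub_pos.2 hβ').ne'
  have j4 := (mul_eq_zero.1 (le_antisymm (by linarith) i4)).resolve_left hβ.ne'
  refine hdet (planeDet_eq_zero_of_inner hd0 ?_ ?_)
  · rw [inner_sub_left]; linarith
  · rw [inner_sub_left]; linarith

theorem exists_isUniqueMinOn_of_planeDet (hu : IsGenericShift W u) (hf : f.support = W)
    (hg : g.support = W) {p : EuclideanSpace ℝ (Fin 2)} {a a' : f.support} {b b' : g.support}
    (ha : a ∈ f.active p) (ha' : a' ∈ f.active p) (hb : b ∈ g.active p) (hb' : b' ∈ g.active p)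
    (hdet : planeDet ((a : EuclideanSpace ℝ (Fin 2)) - a')
      ((b : EuclideanSpace ℝ (Fin 2)) - b') ≠ 0) :
    ∃ s ∈ {s | ∃ a ∈ W, ∃ b ∈ W, a + b = s},
      IsUniqueMinOn (prodTilt f g (s + u)) Set.univ p := by
  have haW : (a : EuclideanSpace ℝ (Fin 2)) ∈ W := hf ▸ a.2
  have haW' : (a' : EuclideanSpace ℝ (Fin 2)) ∈ W := hf ▸ a'.2
  have hbW : (b : EuclideanSpace ℝ (Fin 2)) ∈ W := hg ▸ b.2
  have hbW' : (b' : EuclideanSpace ℝ (Fin 2)) ∈ W := hg ▸ b'.2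
  have hneg : ∀ v w : EuclideanSpace ℝ (Fin 2), planeDet (-v) w = -planeDet v w := by
    intro v w; simp only [planeDet, PiLp.neg_apply]; ring
  have hswap : ∀ v w : EuclideanSpace ℝ (Fin 2), planeDet v w = -planeDet w v := by
    intro v w; simp only [planeDet]; ring
  have hne : ∀ c ∈ W, ∀ c' ∈ W, c - c' ≠ 0 → planeDet u (c - c') ≠ 0 := by
    intro c hc c' hc' h
    have := hu.det_ne c hc c' hc' c hc (sub_ne_zero.1 h)
    rwa [sub_self, zero_sub, hneg, neg_ne_zero] at this
  have hzero : ∀ w : EuclideanSpace ℝ (Fin 2), planeDet 0 w = 0 := by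
    intro w; simp [planeDet]
  have ha0 : planeDet u ((a : EuclideanSpace ℝ (Fin 2)) - a') ≠ 0 :=
    hne _ haW _ haW' fun h => hdet (by rw [h, hzero])
  have hb0 : planeDet u ((b : EuclideanSpace ℝ (Fin 2)) - b') ≠ 0 :=
    hne _ hbW _ hbW' fun h => hdet (by rw [h, hswap, hzero, neg_zero])
  have hab := hu.det_lt _ haW _ haW' _ hbW _ hbW' hdet
  have hba := hu.det_lt _ hbW _ hbW' _ haW _ haW' (by rwa [hswap, neg_ne_zero])
  rw [hswap (_ - _) (_ - _), abs_neg] at hba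
  set D := planeDet ((a : EuclideanSpace ℝ (Fin 2)) - a') ((b : EuclideanSpace ℝ (Fin 2)) - b')
    with hD
  -- Cramer's rule for u in the basis a - a', b - b'. Genericity gives 0 < |α|, |β| < 1, and the
  -- signs select the vertex from which u points into the parallelogram.
  set α := planeDet u ((b : EuclideanSpace ℝ (Fin 2)) - b') / D with hα
  set β := -planeDet u ((a : EuclideanSpace ℝ (Fin 2)) - a') / D with hβ
  have hα0 : α ≠ 0 := div_ne_zero hb0 hdet
  have hβ0 : β ≠ 0 := div_ne_zero (neg_ne_zero.2 ha0) hdet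
  have hα1 : |α| < 1 := by rwa [hα, abs_div, div_lt_one (abs_pos.2 hdet)]
  have hβ1 : |β| < 1 := by rwa [hβ, abs_div, abs_neg, div_lt_one (abs_pos.2 hdet)]
  have hαβ : ∀ i, u i = α * ((a : EuclideanSpace ℝ (Fin 2)) i - (a' : EuclideanSpace ℝ (Fin 2)) i)
      + β * ((b : EuclideanSpace ℝ (Fin 2)) i - (b' : EuclideanSpace ℝ (Fin 2)) i) := by
    intro i
    have h : u i * D = planeDet u ((b : EuclideanSpace ℝ (Fin 2)) - b') *
        ((a : EuclideanSpace ℝ (Fin 2)) i - (a' : EuclideanSpace ℝ (Fin 2)) i) +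
        -planeDet u ((a : EuclideanSpace ℝ (Fin 2)) - a') *
        ((b : EuclideanSpace ℝ (Fin 2)) i - (b' : EuclideanSpace ℝ (Fin 2)) i) := by
      rw [hD]
      simp only [planeDet, PiLp.sub_apply]
      fin_cases i <;> simp only [Fin.zero_eta, Fin.mk_one] <;> ring
    rw [hα, hβ]
    field_simp
    linarith
  obtain ⟨hα2, hα3⟩ := abs_lt.1 hα1
  obtain ⟨hβ2, hβ3⟩ := abs_lt.1 hβ1
  have fin : ∀ (c c' : f.support) (e e' : g.support) (γ δ : ℝ), c ∈ f.active p →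
      c' ∈ f.active p → e ∈ g.active p → e' ∈ g.active p →
      |planeDet ((c : EuclideanSpace ℝ (Fin 2)) - c') ((e : EuclideanSpace ℝ (Fin 2)) - e')| = |D| →
      0 < γ → γ < 1 → 0 < δ → δ < 1 →
      (∀ i, u i = γ * ((c' : EuclideanSpace ℝ (Fin 2)) i - (c : EuclideanSpace ℝ (Fin 2)) i)
        + δ * ((e' : EuclideanSpace ℝ (Fin 2)) i - (e : EuclideanSpace ℝ (Fin 2)) i)) →
      ∃ s ∈ {s | ∃ a ∈ W, ∃ b ∈ W, a + b = s},
        IsUniqueMinOn (prodTilt f g (s + u)) Set.univ p := by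
    intro c c' e e' γ δ hc hc' he he' hdet' h1 h2 h3 h4 h5
    refine ⟨c + e, ⟨c, hf ▸ c.2, e, hg ▸ e.2, rfl⟩,
      isUniqueMinOn_prodTilt_of_mem_parallelogram hc hc' he he' ?_ h1 h2 h3 h4 ?_⟩
    · rw [← abs_pos, hdet']; exact abs_pos.2 hdet
    · ext i
      simpa using h5 i
  have habs : ∀ v w : EuclideanSpace ℝ (Fin 2), |planeDet (-v) w| = |planeDet v w| := by
    intro v w; rw [hneg, abs_neg]
  have habs' : ∀ v w : EuclideanSpace ℝ (Fin 2), |planeDet v (-w)| = |planeDet v w| := by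
    intro v w; rw [hswap, hneg, neg_neg, hswap v w, abs_neg]
  rcases hα0.lt_or_gt with h | h <;> rcases hβ0.lt_or_gt with h' | h'
  · exact fin a a' b b' (-α) (-β) ha ha' hb hb' rfl (by linarith) (by linarith) (by linarith)
      (by linarith) fun i => by rw [hαβ i]; ring
  · exact fin a a' b' b (-α) β ha ha' hb' hb (by
      rw [← neg_sub (b : EuclideanSpace ℝ (Fin 2)), habs']) (by linarith)
      (by linarith) h' hβ3 fun i => by rw [hαβ i]; ring
  · exact fin a' a b b' α (-β) ha' ha hb hb' (by rw [← neg_sub, habs]) h hα3 (by linarith)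
      (by linarith) fun i => by rw [hαβ i]; ring
  · exact fin a' a b' b α β ha' ha hb' hb (by rw [← neg_sub, habs,
      ← neg_sub (b : EuclideanSpace ℝ (Fin 2)), habs']) h hα3
      h' hβ3 fun i => by rw [hαβ i]

/-- As p is interior to the quadrant, the conditions along d and -d force ⟨w + u, d⟩ to equal the
common value of ⟨a, d⟩ for active a, so w + u lies on the line of the active exponents. -/
theorem not_isMinOn_of_direction (hu : IsGenericShift W u) (hf : f.support = W)
    {p d w : EuclideanSpace ℝ (Fin 2)} (hp : p ∈ f.hypersurface) (hpR : ∀ i, p i < R)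
    (hd0 : d ≠ 0) (hd : ∀ a ∈ f.active p, ∀ b ∈ f.active p,
      inner ℝ ((a : EuclideanSpace ℝ (Fin 2)) - b) d = 0) (hw : w ∈ W)
    (hmin : IsUniqueMinOn (f.tilt (w + u)) (quadrant R) p) : False := by
  obtain ⟨a, ha, h1⟩ := exists_active_inner_ge (d := d) hmin.le
    (eventually_mem_quadrant hmin.1 fun i => Or.inl (hpR i))
  obtain ⟨b, hb, h2⟩ := exists_active_inner_ge (d := -d) hmin.le
    (eventually_mem_quadrant hmin.1 fun i => Or.inl (hpR i))
  obtain ⟨c, hc, hca⟩ := hp.exists_ne a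
  have h3 := hd a ha b hb
  have h4 := hd a ha c hc
  refine hu.det_ne a (hf ▸ a.2) c (hf ▸ c.2) w hw (fun h => hca (Subtype.ext h.symm))
    (planeDet_eq_zero_of_inner hd0 ?_ h4)
  simp only [inner_neg_right, inner_sub_left, inner_add_left] at *
  linarith

/-! ### The corner and the overlap of the two families -/

/-- Near the corner of the quadrant only monomials of maximal total degree matter. -/
def HasDominantCorner (f : TropicalPoly 2) (R : ℝ) : Prop :=
  ∀ a b : f.support, (a : EuclideanSpace ℝ (Fin 2)) 0 + (a : EuclideanSpace ℝ (Fin 2)) 1 <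
      (b : EuclideanSpace ℝ (Fin 2)) 0 + (b : EuclideanSpace ℝ (Fin 2)) 1 →
    f.coeff a + ((a : EuclideanSpace ℝ (Fin 2)) 0 + (a : EuclideanSpace ℝ (Fin 2)) 1) * R <
      f.coeff b + ((b : EuclideanSpace ℝ (Fin 2)) 0 + (b : EuclideanSpace ℝ (Fin 2)) 1) * R

theorem eventually_hasDominantCorner (f : TropicalPoly 2) :
    ∀ᶠ R in atTop, f.HasDominantCorner R := by
  refine eventually_all.2 fun a => eventually_all.2 fun b => ?_
  by_cases h : (a : EuclideanSpace ℝ (Fin 2)) 0 + (a : EuclideanSpace ℝ (Fin 2)) 1 <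
      (b : EuclideanSpace ℝ (Fin 2)) 0 + (b : EuclideanSpace ℝ (Fin 2)) 1
  · filter_upwards [(tendsto_id.const_mul_atTop (sub_pos.2 h)).eventually_gt_atTop
      (f.coeff a - f.coeff b)] with R hR _
    simp only [id] at hR
    linarith
  · exact Eventually.of_forall fun _ h' => absurd h' h

theorem HasDominantCorner.le (hR : f.HasDominantCorner R) {q : EuclideanSpace ℝ (Fin 2)}
    (h0 : q 0 = R) (h1 : q 1 = R) {a : f.support} (ha : a ∈ f.active q) (b : f.support) :
    (b : EuclideanSpace ℝ (Fin 2)) 0 + (b : EuclideanSpace ℝ (Fin 2)) 1 ≤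
      (a : EuclideanSpace ℝ (Fin 2)) 0 + (a : EuclideanSpace ℝ (Fin 2)) 1 := by
  by_contra! h
  have h2 := hR a b h
  have h3 : f.monomialValue a q = f.eval q := ha
  have h4 := f.monomialValue_le_eval b q
  rw [← h3] at h4
  simp only [monomialValue, inner_eq_coords, h0, h1] at h4
  linarith

/-- A coordinate direction in which the quadrant extends both ways at `q`, if there is one. -/
noncomputable def freeCoord (R : ℝ) (q : EuclideanSpace ℝ (Fin 2)) : Fin 2 :=
  if q 1 < R then 1 else 0

theorem exists_active_coord_le (hu : IsGenericShift W u) (hf : f.support = W)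
    {w q : EuclideanSpace ℝ (Fin 2)} (hw : w ∈ W)
    (hq : IsUniqueMinOn (f.tilt (w + u)) (quadrant R) q) (i : Fin 2) :
    ∃ a ∈ f.active q, (a : EuclideanSpace ℝ (Fin 2)) i ≤ w i := by
  obtain ⟨a, ha, hle⟩ := exists_active_inner_ge (d := -EuclideanSpace.single i (1 : ℝ)) hq.le
    (eventually_mem_quadrant hq.1 fun j => Or.inr (by by_cases h : j = i <;> simp [h]))
  simp [inner_neg_right, EuclideanSpace.inner_single_right] at hle
  exact ⟨a, ha, hu.coord_le a (hf ▸ a.2) w hw i hle⟩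

theorem exists_active_coord_lt (hu : IsGenericShift W u)
    {w q : EuclideanSpace ℝ (Fin 2)}
    (hq : IsUniqueMinOn (f.tilt (w + u)) (quadrant R) q) {i : Fin 2} (hi : q i < R) :
    ∃ a ∈ f.active q, w i < (a : EuclideanSpace ℝ (Fin 2)) i := by
  obtain ⟨a, ha, hle⟩ := exists_active_inner_ge (d := EuclideanSpace.single i (1 : ℝ)) hq.le
    (eventually_mem_quadrant hq.1 fun j => by
      by_cases h : j = i
      · left; rwa [h]
      · right; simp [h])
  simp [EuclideanSpace.inner_single_right] at hle
  have := hu.pos i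
  exact ⟨a, ha, by linarith⟩

theorem exists_active_height_le (hu : IsGenericShift W u) (hf : f.support = W)
    {w q : EuclideanSpace ℝ (Fin 2)} (hw : w ∈ W)
    (hq : IsUniqueMinOn (f.tilt (w + u)) (quadrant R) q) :
    ∃ a ∈ f.active q, (a : EuclideanSpace ℝ (Fin 2)) 0 + (a : EuclideanSpace ℝ (Fin 2)) 1
      ≤ w 0 + w 1 := by
  obtain ⟨a, ha, hle⟩ := exists_active_inner_ge (d := WithLp.toLp 2 fun _ => (-1 : ℝ)) hq.le
    (eventually_mem_quadrant hq.1 fun j => Or.inr (by simp))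
  simp only [inner_eq_coords, PiLp.add_apply] at hle
  exact ⟨a, ha, hu.height_le a (hf ▸ a.2) w hw (by linarith)⟩

/-- If the free coordinate i has room at q, stepping back gives a i ≤ w i and stepping forward gives
w' i < b i, against the equality of the sums. Hence q is the corner. -/
theorem eq_of_add_eq_add (hu : IsGenericShift W u) (hf : f.support = W) (hg : g.support = W)
    (hfR : f.HasDominantCorner R) (hgR : g.HasDominantCorner R)
    {w w' q : EuclideanSpace ℝ (Fin 2)} (hw : w ∈ W) (hw' : w' ∈ W)
    (hq : IsUniqueMinOn (f.tilt (w + u)) (quadrant R) q)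
    (hq' : IsUniqueMinOn (g.tilt (w' + u)) (quadrant R) q)
    {a : f.support} {b : g.support} (ha : a ∈ f.active q) (hb : b ∈ g.active q)
    (hamin : ∀ c ∈ f.active q, (a : EuclideanSpace ℝ (Fin 2)) (freeCoord R q) ≤
      (c : EuclideanSpace ℝ (Fin 2)) (freeCoord R q))
    (hbmax : ∀ c ∈ g.active q, (c : EuclideanSpace ℝ (Fin 2)) (freeCoord R q) ≤
      (b : EuclideanSpace ℝ (Fin 2)) (freeCoord R q))
    (h : w + b = a + w') : (q 0 = R ∧ q 1 = R) ∧ w = a := by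
  have hcoord : ∀ i, w i + (b : EuclideanSpace ℝ (Fin 2)) i =
      (a : EuclideanSpace ℝ (Fin 2)) i + w' i := fun i => by
    simpa using congrArg (fun x : EuclideanSpace ℝ (Fin 2) => x i) h
  have hcorner : ¬ q (freeCoord R q) < R := by
    intro hlt
    obtain ⟨c, hc, hc'⟩ := exists_active_coord_le hu hf hw hq (freeCoord R q)
    obtain ⟨e, he, he'⟩ := exists_active_coord_lt hu hq' hlt
    have h1 := hamin c hc
    have h2 := hbmax e he
    have h3 := hcoord (freeCoord R q)
    linarith
  have h1 : ¬ q 1 < R := fun hlt => hcorner (by rwa [freeCoord, if_pos hlt])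
  have hfree : freeCoord R q = 0 := if_neg h1
  rw [hfree] at hcorner hamin hbmax
  have q0 : q 0 = R := le_antisymm (hq.1 0) (not_lt.1 hcorner)
  have q1 : q 1 = R := le_antisymm (hq.1 1) (not_lt.1 h1)
  refine ⟨⟨q0, q1⟩, ?_⟩
  -- At the corner, w and a have the same total degree, as do w', e and b. From e 1 ≤ w' 1 follows
  -- w' 0 ≤ e 0 ≤ b 0, while a 0 ≤ c 0 ≤ w 0; equality of the sums forces w 0 = a 0.
  obtain ⟨c, hc, hc'⟩ := exists_active_coord_le hu hf hw hq 0
  obtain ⟨e, he, he'⟩ := exists_active_coord_le hu hg hw' hq' 1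
  obtain ⟨c₁, hc₁, hc₁'⟩ := exists_active_height_le hu hf hw hq
  obtain ⟨e₁, he₁, he₁'⟩ := exists_active_height_le hu hg hw' hq'
  have k1 := hfR.le q0 q1 ha ⟨w, hf ▸ hw⟩
  have k2 := hfR.le q0 q1 hc₁ a
  have k3 := hgR.le q0 q1 he ⟨w', hg ▸ hw'⟩
  have k4 := hgR.le q0 q1 he₁ b
  have k5 := hgR.le q0 q1 he b
  have k6 := hgR.le q0 q1 hb e
  have h2 := hamin c hc
  have h3 := hbmax e he
  have h4 := hcoord 0
  simp only at k1 k3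
  have e0 : w 0 = (a : EuclideanSpace ℝ (Fin 2)) 0 := by linarith
  ext i
  fin_cases i
  · exact e0
  · change w 1 = (a : EuclideanSpace ℝ (Fin 2)) 1
    linarith

/-! ### Counting in W + W -/

theorem card_transverse_add_le [DecidableEq (EuclideanSpace ℝ (Fin 2))]
    (hf : f.support = W) (hg : g.support = W) (P : Finset (EuclideanSpace ℝ (Fin 2)))
    (hP : ∀ p ∈ P, IsTransverseAt ![f, g] p) : P.card + 2 * W.card ≤ (W + W).card + 1 := by
  obtain ⟨u, hu⟩ := exists_isGenericShift W
  have hPR : ∀ᶠ R in atTop, ∀ p ∈ P, ∀ i, p i < R :=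
    (eventually_all_finset P).2 fun p _ => eventually_all.2 fun i => eventually_gt_atTop (p i)
  obtain ⟨R, ⟨hfR, hgR⟩, hPR⟩ := (((eventually_hasDominantCorner f).and
    (eventually_hasDominantCorner g)).and hPR).exists
  have hsol : ∀ p : P, ∃ s ∈ {s | ∃ a ∈ W, ∃ b ∈ W, a + b = s},
      IsUniqueMinOn (prodTilt f g (s + u)) Set.univ p := by
    intro p
    obtain ⟨⟨a, ha, a', ha', b, hb, b', hb', hdet⟩, -, -⟩ :=
      exists_directions_of_isTransverseAt (hP p p.2)
    exact exists_isUniqueMinOn_of_planeDet hu hf hg ha ha' hb hb' hdet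
  choose sol hsolW hsol using hsol
  replace hsol : ∀ p : P, IsUniqueMinOn (prodTilt f g (sol p + u)) (quadrant R) p := fun p =>
    ⟨fun i => (hPR p p.2 i).le, fun x _ h => (hsol p).2 x (Set.mem_univ _) h⟩
  choose qf hqf using fun w : W => exists_isUniqueMinOn_quadrant hu hf R w.2
  choose qg hqg using fun w : W => exists_isUniqueMinOn_quadrant hu hg R w.2
  -- The choice depends only on q, which gives injectivity of φ and ψ; the opposite extremes for a
  -- and b are what limits their overlap.
  choose a ha hamin using fun q => Set.exists_min_image (f.active q)
    (fun c => (c : EuclideanSpace ℝ (Fin 2)) (freeCoord R q)) (Set.toFinite _)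
    (f.exists_mem_active q)
  choose b hb hbmax using fun q => Set.exists_max_image (g.active q)
    (fun c => (c : EuclideanSpace ℝ (Fin 2)) (freeCoord R q)) (Set.toFinite _)
    (g.exists_mem_active q)
  set φ : W → EuclideanSpace ℝ (Fin 2) := fun w => w + b (qf w) with hφ
  set ψ : W → EuclideanSpace ℝ (Fin 2) := fun w => a (qg w) + w with hψ
  have hφmin : ∀ w, IsUniqueMinOn (prodTilt f g (φ w + u)) (quadrant R) (qf w) := fun w =>
    isUniqueMinOn_prodTilt (hqf w) (hb _)
  have hψmin : ∀ w, IsUniqueMinOn (prodTilt f g (ψ w + u)) (quadrant R) (qg w) := fun w => by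
    rw [prodTilt_comm, hψ]
    simp only [add_comm (a _ : EuclideanSpace ℝ (Fin 2))]
    exact isUniqueMinOn_prodTilt (hqg w) (ha _)
  have hsolinj : Function.Injective sol := fun p p' h =>
    Subtype.ext ((hsol p).eq (h ▸ hsol p'))
  have hφinj : Function.Injective φ := fun w w' h => by
    have hq : qf w = qf w' := (hφmin w).eq (h ▸ hφmin w')
    simp only [hφ, hq, add_left_inj] at h
    exact Subtype.ext h
  have hψinj : Function.Injective ψ := fun w w' h => by
    have hq : qg w = qg w' := (hψmin w).eq (h ▸ hψmin w')
    simp only [hψ, hq, add_right_inj] at h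
    exact Subtype.ext h
  have hsolφ : ∀ p w, sol p ≠ φ w := fun p w h => by
    have hq : (p : EuclideanSpace ℝ (Fin 2)) = qf w := (hsol p).eq (h ▸ hφmin w)
    have hT := hP p p.2
    obtain ⟨-, ⟨d, hd0, hd⟩, -⟩ := exists_directions_of_isTransverseAt hT
    exact not_isMinOn_of_direction hu hf (hT.1 0) (hPR p p.2) hd0 hd w.2 (hq ▸ hqf w)
  have hsolψ : ∀ p w, sol p ≠ ψ w := fun p w h => by
    have hq : (p : EuclideanSpace ℝ (Fin 2)) = qg w := (hsol p).eq (h ▸ hψmin w)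
    have hT := hP p p.2
    obtain ⟨-, -, ⟨d, hd0, hd⟩⟩ := exists_directions_of_isTransverseAt hT
    exact not_isMinOn_of_direction hu hg (hT.1 1) (hPR p p.2) hd0 hd w.2 (hq ▸ hqg w)
  set c : EuclideanSpace ℝ (Fin 2) := WithLp.toLp 2 fun _ => R with hc
  have hover : ∀ w w', φ w = ψ w' → φ w = a c + b c := fun w w' h => by
    have hq : qf w = qg w' := (hφmin w).eq (h ▸ hψmin w')
    have h' : (w : EuclideanSpace ℝ (Fin 2)) + b (qf w) = a (qf w) + w' := by
      simpa only [hφ, hψ, ← hq] using h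
    obtain ⟨⟨q0, q1⟩, hwa⟩ := eq_of_add_eq_add hu hf hg hfR hgR w.2 w'.2 (hqf w)
      (hq ▸ hqg w') (ha _) (hb _) (hamin _) (hbmax _) h'
    have hqc : qf w = c := by
      ext i
      fin_cases i
      · exact q0
      · exact q1
    simp only [hφ]
    rw [hwa, hqc]
  set S := Finset.univ.image sol with hS
  set Φ := Finset.univ.image φ with hΦ
  set Ψ := Finset.univ.image ψ with hΨ
  have cS : S.card = P.card := by
    rw [hS, Finset.card_image_of_injective _ hsolinj, Finset.card_univ, Fintype.card_coe]
  have cΦ : Φ.card = W.card := by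
    rw [hΦ, Finset.card_image_of_injective _ hφinj, Finset.card_univ, Fintype.card_coe]
  have cΨ : Ψ.card = W.card := by
    rw [hΨ, Finset.card_image_of_injective _ hψinj, Finset.card_univ, Fintype.card_coe]
  have cI : (Φ ∩ Ψ).card ≤ 1 := by
    refine Finset.card_le_one_iff_subset_singleton.2 ⟨(a c : EuclideanSpace ℝ (Fin 2)) + b c, ?_⟩
    intro s hs
    obtain ⟨h1, h2⟩ := Finset.mem_inter.1 hs
    obtain ⟨w, -, rfl⟩ := Finset.mem_image.1 h1
    obtain ⟨w', -, h⟩ := Finset.mem_image.1 h2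
    exact Finset.mem_singleton.2 (hover w w' h.symm)
  have hdisj : Disjoint S (Φ ∪ Ψ) := by
    rw [Finset.disjoint_left]
    intro s hs hs'
    obtain ⟨p, -, rfl⟩ := Finset.mem_image.1 hs
    rcases Finset.mem_union.1 hs' with h | h
    · obtain ⟨w, -, h⟩ := Finset.mem_image.1 h
      exact hsolφ p w h.symm
    · obtain ⟨w, -, h⟩ := Finset.mem_image.1 h
      exact hsolψ p w h.symm
  have hsub : S ∪ (Φ ∪ Ψ) ⊆ W + W := by
    refine Finset.union_subset ?_ (Finset.union_subset ?_ ?_)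
    · intro s hs
      obtain ⟨p, -, rfl⟩ := Finset.mem_image.1 hs
      obtain ⟨x, hx, y, hy, h⟩ := hsolW p
      exact Finset.mem_add.2 ⟨x, hx, y, hy, h⟩
    · intro s hs
      obtain ⟨w, -, rfl⟩ := Finset.mem_image.1 hs
      exact Finset.add_mem_add w.2 (hg ▸ (b (qf w)).2)
    · intro s hs
      obtain ⟨w, -, rfl⟩ := Finset.mem_image.1 hs
      exact Finset.add_mem_add (hf ▸ (a (qg w)).2) w.2
  have h1 := Finset.card_le_card hsub
  rw [Finset.card_union_of_disjoint hdisj] at h1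
  have h2 := Finset.card_union_add_card_inter Φ Ψ
  omega

end TropicalPoly

theorem finite_and_ncard_nondegenerateSolutions_le {W : Finset (EuclideanSpace ℝ (Fin 2))}
    {f g : TropicalPoly 2} (hf : f.support = W) (hg : g.support = W) :
    (nondegenerateSolutions ![f, g]).Finite ∧
      ((nondegenerateSolutions ![f, g]).ncard : ℝ) ≤
        ((W.card : ℝ) - 1) * ((W.card : ℝ) - 2) / 2 := by
  classical
  have hfin : (nondegenerateSolutions ![f, g]).Finite := by
    by_contra hinf
    -- Any size above |W + W| + 1 contradicts the count.
    obtain ⟨P, hP, hcard⟩ := Set.Infinite.exists_subset_card_eq hinf ((W + W).card + 2)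
    have := TropicalPoly.card_transverse_add_le hf hg P fun p hp => hP hp
    omega
  refine ⟨hfin, ?_⟩
  have h := TropicalPoly.card_transverse_add_le hf hg hfin.toFinset fun p hp =>
    hfin.mem_toFinset.1 hp
  rw [← Set.ncard_eq_toFinset_card _ hfin] at h
  have h1 := two_mul_card_add_self_le W
  have h2 : ((nondegenerateSolutions ![f, g]).ncard : ℝ) + 2 * W.card ≤ (W + W).card + 1 := by
    exact_mod_cast h
  linarith

theorem propositionP :
    (∀ (n : ℕ) (W : Finset (EuclideanSpace ℝ (Fin n))),
      (discreteMixedVolume ![W, W] : ℝ) ≤ ((W.card : ℝ) - 1) * ((W.card : ℝ) - 2) / 2) ∧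
    (∀ (W : Finset (EuclideanSpace ℝ (Fin 2))) (f g : TropicalPoly 2),
      f.support = W → g.support = W →
        (nondegenerateSolutions ![f, g]).Finite ∧
          ((nondegenerateSolutions ![f, g]).ncard : ℝ) ≤
            ((W.card : ℝ) - 1) * ((W.card : ℝ) - 2) / 2) :=
  ⟨fun _ W => discreteMixedVolume_pair_le W,
    fun _ _ _ hf hg => finite_and_ncard_nondegenerateSolutions_le hf hg⟩
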